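/- Fix $n\ge 1$ and a linear macro-vertex on $n$ nodes, i.e. the directed path $n\to n-1\to\cdots\to 1$ together with some (possibly none, possibly all) of the reverse arcs $p\to p+1$. For $m\ge 1$ let $\mathcal G_{m,n}$ be the ring digraph on $N=mn$ nodes made of $m$ disjoint copies of this macro-vertex and of $m$ further arcs, which lead from the first node of each copy to the last node of the cyclically preceding copy (arcs are counted with multiplicity; for $m=1$ the further arc goes from the first to the last node of the single copy). Let $(a_{ik})$ be its adjacency matrix and $\mathcal L_N$ its Laplacian matrix, with entries $l_{ik}=-a_{ik}$ for $i\ne k$ and $l_{ii}=\sum_{k\ne i}a_{ik}$. Let $\mathbf a(s)=s^d+\mathbf a_{d-1}s^{d-1}+\dots+\mathbf a_0$ and $\mathbf b(s)=\mathbf b_qs^q+\dots+\mathbf b_0\neq 0$ be real polynomials with $d>q=\deg\mathbf b$ that have no common zero in the closed right half-plane, and let $\phi=\mathbf a/\mathbf b$. Consider the system $\mathbf a(s)x=\mathbf b(s)(-\mathcal L_Nx)$, $s=\frac{d}{dt}$, in its state-space form: for the states $\xi_i=(x_i,\dot x_i,\dots,x_i^{(d-1)})^\top$, $i=1,\dots,N$,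 $$\dot\xi_i=A\xi_i+Bu_i,\qquad u_i=K\sum_{k}a_{ik}(\xi_k-\xi_i),$$ where $A$ is the companion matrix of $\mathbf a$ (ones on the superdiagonal, last row $(-\mathbf a_0,\dots,-\mathbf a_{d-1})$), $B=(0,\dots,0,1)^\top$ and $K=(\mathbf b_0,\dots,\mathbf b_q,0,\dots,0)$. The system reaches consensus if $\lim_{t\to\infty}\|\xi_i(t)-\xi_k(t)\|=0$ for all $i,k$ and every initial condition. Let $$\Omega=\{\lambda\in\mathbb C:\ \phi(s)-\lambda\ne0\ \text{ for all } s \text{ in the domain of } \phi \text{ with } \operatorname{Re}s\ge0\}$$ be the consensus region of $\phi$, and let $\Lambda\subset\mathbb C$ be the locus of the spectrum of $-\mathcal L_N$, i.e. the set of all eigenvalues of the matrices $-\mathcal L_{mn}$, $m=1,2,\dots$ Then the system reaches consensus for all numbers of agents $N=mn$, $m\ge1$, if and only if $\Lambda\setminus\{0\}\subseteq\Omega$ and $\Lambda\cap\partial\Omega\subseteq\{0\}$. Moreover, if $\mathbf a$ has a zero in the closed right half-plane (for instance $\mathbf a(0)=0$, agents containing an integrator), then the system reaches consensus for all these $N$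 if and only if $\Lambda\setminus\{0\}\subseteq\Omega$ and $\Lambda\cap\partial\Omega=\{0\}$. -/

import Mathlib

open Polynomial Filter Topology

noncomputable section

namespace RingConsensus

/-! ### Digraphs with multiple arcs, adjacency and Laplacian matrices -/

/-- The adjacency matrix of the digraph on `V` with multiset of arcs `E`: the entry `(i, k)` is the
number of arcs from `i` to `k`. -/
def adjacencyMatrix {V : Type*} [DecidableEq V] (E : Multiset (V × V)) : Matrix V V ℝ :=
  Matrix.of fun i k => (E.count (i, k) : ℝ)

/-- The Laplacian matrix: `l i i = ∑ k ≠ i, a i k` and `l i k = - a i k` for `i ≠ k`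
(loops do not contribute). -/
def laplacianMatrix {V : Type*} [Fintype V] [DecidableEq V] (E : Multiset (V × V)) :
    Matrix V V ℝ :=
  Matrix.of fun i k =>
    if i = k then ∑ l ∈ Finset.univ.erase i, adjacencyMatrix E i l else -adjacencyMatrix E i k

/-! ### Ring digraphs

The node `(i, p) : Fin m × Fin n` is the `p`-th node of the `i`-th macro-vertex, both counted from
`0`, i.e. node number `n * i + p + 1` of the ring digraph. -/

/-- The arcs of `m` disjoint copies of the linear macro-vertex on `n` nodes: the main path
`n-1 → n-2 → ⋯ → 0`, and those arcs `p → p + 1` of the reverse path that are kept, namely those with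
`p ∈ R` (the last node has no successor, so its membership in `R` is irrelevant). -/
def macroVertexArcs (m n : ℕ) (R : Finset (Fin n)) :
    Finset ((Fin m × Fin n) × (Fin m × Fin n)) :=
  Finset.univ.filter fun e =>
    e.1.1 = e.2.1 ∧
      ((e.1.2 : ℕ) = (e.2.2 : ℕ) + 1 ∨ ((e.2.2 : ℕ) = (e.1.2 : ℕ) + 1 ∧ e.1.2 ∈ R))

/-- The `m` arcs of the Hamiltonian cycle on the macro-vertices: they lead from the first node of
each macro-vertex to the last node of the (cyclically) previous one. -/
def linkArcs (m n : ℕ) : Finset ((Fin m × Fin n) × (Fin m × Fin n)) :=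
  Finset.univ.filter fun e =>
    e.1.1 = finRotate m e.2.1 ∧ (e.1.2 : ℕ) = 0 ∧ (e.2.2 : ℕ) + 1 = n

/-- The multiset of arcs of the ring digraph composed of `m` copies of the linear macro-vertex on
`n` nodes given by `R`. It is a sum of multisets: for `m = 1`, `n = 2` an arc can be double. -/
def ringArcs (m n : ℕ) (R : Finset (Fin n)) : Multiset ((Fin m × Fin n) × (Fin m × Fin n)) :=
  (macroVertexArcs m n R).val + (linkArcs m n).val

/-- The locus of the spectrum of the matrices `-L` for all ring digraphs built from
the given macro-vertex: the set of all (complex) eigenvalues, for all numbers `m ≥ 1` of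
macro-vertices. -/
def spectrumLocus (n : ℕ) (R : Finset (Fin n)) : Set ℂ :=
  ⋃ m ∈ Set.Ici (1 : ℕ),
    spectrum ℂ (-((laplacianMatrix (ringArcs m n R)).map (fun x : ℝ => (x : ℂ))))

/-! ### Agents, the network system, consensus -/

/-- The companion matrix `A` of `a(s) = s ^ d + a_{d-1} s ^ (d-1) + ⋯ + a_0`. -/
def stateMatrix (a : ℝ[X]) : Matrix (Fin a.natDegree) (Fin a.natDegree) ℝ :=
  Matrix.of fun i j =>
    if (i : ℕ) + 1 = a.natDegree then -a.coeff j
    else if (j : ℕ) = (i : ℕ) + 1 then 1 else 0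

/-- The input vector `B = (0, …, 0, 1)`. -/
def inputVector (a : ℝ[X]) : Fin a.natDegree → ℝ :=
  fun i => if (i : ℕ) + 1 = a.natDegree then 1 else 0

/-- The gain row `K = (b_0, …, b_q, 0, …, 0)`, of length `d = deg a`. -/
def gainRow (a b : ℝ[X]) : Fin a.natDegree → ℝ :=
  fun j => b.coeff j

/-- The control signal `u_i = K ∑ k, a i k (ξ k - ξ i)` (nodes that are not neighbours of `i`
contribute `0`). -/
def control {V : Type*} [Fintype V] [DecidableEq V] (a b : ℝ[X]) (E : Multiset (V × V))
    (ξ : V → Fin a.natDegree → ℝ) (i : V) : ℝ :=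
  gainRow a b ⬝ᵥ ∑ k, adjacencyMatrix E i k • (ξ k - ξ i)

/-- `ξ` is a trajectory, on the time interval `[0, ∞)`, of the network system
`ξ_i' = A ξ_i + B u_i`; here `ξ_i = (x_i, x_i', …, x_i^(d-1))`. -/
def IsTrajectory {V : Type*} [Fintype V] [DecidableEq V] (a b : ℝ[X]) (E : Multiset (V × V))
    (ξ : ℝ → V → Fin a.natDegree → ℝ) : Prop :=
  ∀ t : ℝ, 0 ≤ t → ∀ i : V,
    HasDerivWithinAt (fun τ => ξ τ i)
      (Matrix.mulVec (stateMatrix a) (ξ t i) + control a b E (ξ t) i • inputVector a)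
      (Set.Ici 0) t

/-- The network system reaches consensus: along every trajectory (so for every initial condition)
the states of any two agents approach each other. -/
def ReachesConsensus {V : Type*} [Fintype V] [DecidableEq V] (a b : ℝ[X])
    (E : Multiset (V × V)) : Prop :=
  ∀ ξ : ℝ → V → Fin a.natDegree → ℝ, IsTrajectory a b E ξ →
    ∀ i k : V, Tendsto (fun t => ‖ξ t i - ξ t k‖) atTop (𝓝 0)

/-! ### The consensus region -/

/-- The generalized frequency variable `φ(s) = a(s) / b(s)`. -/
def phi (a b : ℝ[X]) (s : ℂ) : ℂ := aeval s a / aeval s b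

/-- The consensus region `Ω` of `φ = a / b`: the set of `z` for which `φ - z` has no zero in the
closed right half-plane. The points with `b(s) = 0` are outside the domain of `φ`. -/
def consensusRegion (a b : ℝ[X]) : Set ℂ :=
  {z | ∀ s : ℂ, 0 ≤ s.re → aeval s b ≠ 0 → phi a b s - z ≠ 0}

end RingConsensus

end

noncomputable section

namespace RingConsensus

/-! ### Asymptotically stable linear differential equations -/

/-! Write `N` for the negative Laplacian. For a functional `w` on the nodes, the combination `y_w =
∑ w_i ξ_i` satisfies `y_w' = (A + l B K) y_w + B K y_{w(N - l)}` for every `l`. If `w` is killed by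
a product of factors `N - l`, this is a cascade of small systems, each driven by the next. The
eigenvalues of `A + l B K` are zeros of `a - l b`, so when every `l` involved is stable the cascade
decays from its end upwards (`tendsto_sum_mul_zero`). The ring is strongly connected, so the maximum
principle shows that the generalized kernel of `N` contains only constant vectors. Hence `e_i - e_k`
is killed by the product over the nonzero eigenvalues alone, which gives consensus. Conversely, an
eigenvector for an unstable `l ≠ 0` is not constant, and it yields an exponential trajectory without
consensus. As `a` and `b` have no common zero in the closed right half-plane, consensus for all `m`
thus means `Λ \ {0} ⊆ Ω`. The boundary conditions follow from topology. `Ω` is open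
(`isOpen_setOf_stable`), so it misses its frontier and only `0` can lie in `Λ ∩ ∂Ω`. If `a` has a
zero in the closed right half-plane, then `0 ∉ Ω`; but `0` is a limit of nonzero points of `Λ`
(`exists_mem_spectrumLocus_norm_lt`), so `0` does lie in `∂Ω`. -/

/-- A scalar equation `y' = μ y + g` with `Re μ < 0` and a vanishing perturbation `g`. -/
theorem tendsto_zero_of_hasDerivWithinAt {μ : ℂ} (hμ : μ.re < 0) {y g : ℝ → ℂ}
    (hy : ∀ t : ℝ, 0 ≤ t → HasDerivWithinAt y (μ * y t + g t) (Set.Ici 0) t)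
    (hg : Tendsto g atTop (𝓝 0)) : Tendsto y atTop (𝓝 0) := by
  set c : ℝ := -μ.re with hc
  have hc0 : 0 < c := by simpa [hc] using hμ
  have hnorm : ∀ t : ℝ, ‖Complex.exp (-(μ * t))‖ = Real.exp (c * t) := fun t => by
    rw [Complex.norm_exp]; simp [hc]
  rw [Metric.tendsto_atTop]
  intro ε hε
  -- With `|g| < ε c / 2`, the driving term contributes at most `ε / 2` to `y` in the limit.
  obtain ⟨t₁, ht₁⟩ := (Metric.tendsto_atTop.1 hg) (ε * c / 2) (by positivity)
  set t₀ := max t₁ 0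
  have ht₀ : 0 ≤ t₀ := le_max_right _ _
  -- Integrating factor: the derivative of `z` no longer involves `y`.
  set z : ℝ → ℂ := fun t => Complex.exp (-(μ * t)) * y t with hz
  have hzd : ∀ t : ℝ, 0 ≤ t →
      HasDerivWithinAt z (Complex.exp (-(μ * t)) * g t) (Set.Ici 0) t := by
    intro t ht
    have h1 : HasDerivAt (fun t : ℝ => Complex.exp (-(μ * t)))
        (Complex.exp (-(μ * t)) * (-(μ * 1))) t :=
      (((Complex.ofRealCLM.hasDerivAt (x := t)).const_mul μ).neg).cexp
    exact (h1.hasDerivWithinAt.mul (hy t ht)).congr_deriv (by ring)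
  set B : ℝ → ℝ := fun t => ‖z t₀‖ + ε / 2 * (Real.exp (c * t) - Real.exp (c * t₀)) with hB
  have hbound : ∀ t, t₀ ≤ t → ‖z t‖ ≤ B t := by
    intro t ht
    refine image_norm_le_of_norm_deriv_right_le_deriv_boundary
      (f' := fun t => Complex.exp (-(μ * t)) * g t)
      (B' := fun t => ε / 2 * (Real.exp (c * t) * (c * 1))) (a := t₀) (b := t) ?_ ?_ ?_ ?_ ?_ ⟨ht, le_rfl⟩
    · intro s hs
      exact ((hzd s (ht₀.trans hs.1)).continuousWithinAt).mono
        fun r hr => Set.mem_Ici.2 (ht₀.trans hr.1)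
    · intro s hs
      exact (hzd s (ht₀.trans hs.1)).mono fun r hr => Set.mem_Ici.2 ((ht₀.trans hs.1).trans hr)
    · simp [hB]
    · intro s
      exact ((((hasDerivAt_id s).const_mul c).exp.sub_const _).const_mul _).const_add _
    · intro s hs
      have := ht₁ s ((le_max_left _ _).trans hs.1)
      rw [dist_zero_right] at this
      rw [norm_mul, hnorm]
      nlinarith [Real.exp_pos (c * s)]
  have hy' : ∀ t, ‖y t‖ = Real.exp (-(c * t)) * ‖z t‖ := by
    intro t
    rw [hz, norm_mul, hnorm, ← mul_assoc, ← Real.exp_add]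
    simp
  have hlim : Tendsto (fun t : ℝ => Real.exp (-(c * t)) * ‖z t₀‖) atTop (𝓝 0) := by
    have : Tendsto (fun t : ℝ => Real.exp (-(c * t))) atTop (𝓝 0) :=
      Real.tendsto_exp_neg_atTop_nhds_zero.comp (tendsto_id.const_mul_atTop hc0)
    simpa using this.mul_const ‖z t₀‖
  obtain ⟨t₂, ht₂⟩ := (Metric.tendsto_atTop.1 hlim) (ε / 2) (by positivity)
  refine ⟨max t₀ t₂, fun t ht => ?_⟩
  have h2 := ht₂ t ((le_max_right _ _).trans ht)
  have h1 := hbound t ((le_max_left _ _).trans ht)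
  rw [dist_zero_right] at h2 ⊢
  rw [Real.norm_of_nonneg (by positivity)] at h2
  rw [hy']
  have h3 : Real.exp (-(c * t)) * Real.exp (c * t) = 1 := by rw [← Real.exp_add]; simp
  have h4 := Real.exp_pos (-(c * t))
  have h5 : 0 < Real.exp (-(c * t)) * Real.exp (c * t₀) := by positivity
  calc Real.exp (-(c * t)) * ‖z t‖ ≤ Real.exp (-(c * t)) * B t := by gcongr
    _ = Real.exp (-(c * t)) * ‖z t₀‖ + ε / 2 * (Real.exp (-(c * t)) * Real.exp (c * t))
        - ε / 2 * (Real.exp (-(c * t)) * Real.exp (c * t₀)) := by simp only [hB]; ring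
    _ < ε := by rw [h3]; nlinarith

theorem aeval_charpoly_eq_prod {ι : Type*} [Fintype ι] [DecidableEq ι] (M : Matrix ι ι ℂ) :
    aeval M ((M.charpoly.roots.map fun μ => X - C μ).prod) = 0 := by
  rw [← (IsAlgClosed.splits M.charpoly).eq_prod_roots_of_monic M.charpoly_monic,
    Matrix.aeval_self_charpoly]

/-- A functional `w` killed by `∏ (M - μ)` with `Re μ < 0` vanishes asymptotically along the
solutions of `z' = M z + g`. -/
theorem tendsto_dotProduct_zero {ι : Type*} [Fintype ι] [DecidableEq ι] {M : Matrix ι ι ℂ}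
    {z g : ℝ → ι → ℂ}
    (hz : ∀ t : ℝ, 0 ≤ t → HasDerivWithinAt z (M.mulVec (z t) + g t) (Set.Ici 0) t)
    (hg : Tendsto g atTop (𝓝 0)) (s : Multiset ℂ) (hs : ∀ μ ∈ s, μ.re < 0) :
    ∀ w : ι → ℂ, Matrix.vecMul w (aeval M ((s.map fun μ => X - C μ).prod)) = 0 →
      Tendsto (fun t => w ⬝ᵥ z t) atTop (𝓝 0) := by
  induction s using Multiset.induction with
  | empty => intro w hw; simp at hw; simp [hw]
  | cons μ s ih =>
    intro w hw
    -- `w (M - μ)` is killed by the shorter product, so it supplies a vanishing perturbation in the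
    -- scalar equation for `w`.
    have h1 := ih (fun ν hν => hs ν (Multiset.mem_cons_of_mem hν))
      (Matrix.vecMul w (M - μ • 1)) (by
        simpa [Matrix.vecMul_vecMul, Algebra.algebraMap_eq_smul_one] using hw)
    have h2 : Tendsto (fun t => w ⬝ᵥ g t) atTop (𝓝 0) := by
      have : Continuous fun v : ι → ℂ => w ⬝ᵥ v := by fun_prop
      have h := (this.tendsto 0).comp hg
      rwa [dotProduct_zero] at h
    refine tendsto_zero_of_hasDerivWithinAt (hs μ (Multiset.mem_cons_self _ _))
      (g := fun t => Matrix.vecMul w (M - μ • 1) ⬝ᵥ z t + w ⬝ᵥ g t) ?_ (by simpa using h1.add h2)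
    intro t ht
    have h3 : HasDerivWithinAt (fun t => w ⬝ᵥ z t) (w ⬝ᵥ (M.mulVec (z t) + g t)) (Set.Ici 0) t := by
      unfold dotProduct
      exact HasDerivWithinAt.fun_sum fun i _ =>
        ((hasDerivWithinAt_pi.1 (hz t ht)) i).const_mul (w i)
    convert h3 using 1
    rw [dotProduct_add, Matrix.dotProduct_mulVec, Matrix.vecMul_sub, Matrix.vecMul_smul,
      Matrix.vecMul_one, sub_dotProduct, smul_dotProduct, smul_eq_mul]
    ring

theorem exists_eigenvector {ι : Type*} [Fintype ι] [DecidableEq ι] {M : Matrix ι ι ℂ} {μ : ℂ}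
    (h : μ ∈ spectrum ℂ M) : ∃ v : ι → ℂ, v ≠ 0 ∧ M.mulVec v = μ • v := by
  rw [← Matrix.spectrum_toLin', ← Module.End.hasEigenvalue_iff_mem_spectrum] at h
  obtain ⟨v, hv⟩ := h.exists_hasEigenvector
  exact ⟨v, hv.2, by simpa using hv.apply_eq_smul⟩

theorem mem_spectrum_of_mulVec {ι : Type*} [Fintype ι] [DecidableEq ι] {M : Matrix ι ι ℂ} {μ : ℂ}
    {v : ι → ℂ} (hv : v ≠ 0) (h : M.mulVec v = μ • v) : μ ∈ spectrum ℂ M := by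
  rw [← Matrix.spectrum_toLin', ← Module.End.hasEigenvalue_iff_mem_spectrum]
  exact Module.End.hasEigenvalue_of_hasEigenvector
    (x := v) ⟨Module.End.mem_eigenspace_iff.2 (by simpa using h), hv⟩

/-- By Cayley–Hamilton every coordinate functional is killed by the full characteristic product, so
neither Jordan forms nor matrix exponentials are needed. -/
theorem tendsto_zero_of_stable {ι : Type*} [Fintype ι] [DecidableEq ι] {M : Matrix ι ι ℂ}
    (hM : ∀ μ ∈ spectrum ℂ M, μ.re < 0) {z g : ℝ → ι → ℂ}
    (hz : ∀ t : ℝ, 0 ≤ t → HasDerivWithinAt z (M.mulVec (z t) + g t) (Set.Ici 0) t)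
    (hg : Tendsto g atTop (𝓝 0)) : Tendsto z atTop (𝓝 0) := by
  rw [tendsto_pi_nhds]
  intro i
  have := tendsto_dotProduct_zero hz hg M.charpoly.roots
    (fun μ hμ => hM μ (Matrix.mem_spectrum_of_isRoot_charpoly (isRoot_of_mem_roots hμ)))
    (Pi.single i 1) (by rw [aeval_charpoly_eq_prod, Matrix.vecMul_zero])
  simpa using this

/-! ### Negative Laplacian matrices and the maximum principle -/

variable {V : Type*} [Fintype V] [DecidableEq V]

/-- The complex matrix `-L`. -/
abbrev negLaplacian (E : Multiset (V × V)) : Matrix V V ℂ :=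
  -((laplacianMatrix E).map (fun x : ℝ => (x : ℂ)))

/-- In difference form loops contribute zero, so the sum may run over all nodes. -/
theorem negLaplacian_mulVec (E : Multiset (V × V)) (v : V → ℂ) (i : V) :
    (negLaplacian E).mulVec v i = ∑ k, (adjacencyMatrix E i k : ℂ) * (v k - v i) := by
  have h1 : ∀ k, ((negLaplacian E) i k) * v k =
      (adjacencyMatrix E i k : ℂ) * v k - if i = k then
        (∑ l, (adjacencyMatrix E i l : ℂ)) * v k else 0 := by
    intro k
    by_cases h : i = k
    · subst h
      simp only [negLaplacian, laplacianMatrix, Matrix.neg_apply, Matrix.map_apply,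
        Matrix.of_apply, if_true]
      rw [Finset.sum_erase_eq_sub (Finset.mem_univ i)]
      push_cast
      ring
    · simp [negLaplacian, laplacianMatrix, h]
  rw [Matrix.mulVec, dotProduct, Finset.sum_congr rfl fun k _ => h1 k, Finset.sum_sub_distrib,
    Finset.sum_ite_eq]
  simp [mul_sub, Finset.sum_sub_distrib, Finset.sum_mul]

/-- Strong connectivity: the only nonempty set of nodes closed under passing to heads of arcs
is the whole set. -/
def StronglyConnected (E : Multiset (V × V)) : Prop :=
  ∀ S : Set V, S.Nonempty → (∀ i ∈ S, ∀ k, (i, k) ∈ E → k ∈ S) → S = Set.univ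

theorem adjacencyMatrix_nonneg {V : Type*} [DecidableEq V] (E : Multiset (V × V)) (i k : V) : 0 ≤ adjacencyMatrix E i k := by
  simp [adjacencyMatrix]

/-- The maximum principle. -/
theorem eq_of_subharmonic {E : Multiset (V × V)} (hE : StronglyConnected E) {u : V → ℝ}
    (hu : ∀ i, 0 ≤ ∑ k, adjacencyMatrix E i k * (u k - u i)) (i k : V) : u i = u k := by
  obtain ⟨j, -, hj⟩ := Finset.exists_max_image Finset.univ u ⟨i, Finset.mem_univ i⟩
  -- The set where `u` attains its maximum is closed under arcs: at a maximum all terms of the sum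
  -- are nonpositive while the sum is nonnegative.
  have hS := hE {l | u l = u j} ⟨j, rfl⟩ (by
    intro l hl r hr
    have hterm : ∀ r ∈ Finset.univ, adjacencyMatrix E l r * (u r - u l) ≤ 0 := fun r _ =>
      mul_nonpos_of_nonneg_of_nonpos (adjacencyMatrix_nonneg E l r)
        (by have : u l = u j := hl
            linarith [hj r (Finset.mem_univ r)])
    have hzero := (Finset.sum_eq_zero_iff_of_nonpos hterm).1
      (le_antisymm (Finset.sum_nonpos hterm) (hu l)) r (Finset.mem_univ r)
    have hpos : adjacencyMatrix E l r ≠ 0 := by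
      simpa [adjacencyMatrix] using hr
    have := (mul_eq_zero.1 hzero).resolve_left hpos
    have hl' : u l = u j := hl
    exact (sub_eq_zero.1 this).trans hl')
  have h : ∀ l, u l = u j := fun l => by
    have : l ∈ {l | u l = u j} := hS ▸ Set.mem_univ l
    exact this
  rw [h i, h k]

/-- According to the sign of `c`, either `u` or `-u` is subharmonic. Allowing `c ≠ 0` is what
excludes Jordan chains at the eigenvalue `0`. -/
theorem eq_of_laplacian_const {E : Multiset (V × V)} (hE : StronglyConnected E) {u : V → ℝ}
    {c : ℝ} (hu : ∀ i, ∑ k, adjacencyMatrix E i k * (u k - u i) = c) (i k : V) : u i = u k := by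
  rcases le_total 0 c with hc | hc
  · exact eq_of_subharmonic hE (fun i => (hu i).symm ▸ hc) i k
  · have := eq_of_subharmonic hE (u := fun i => -u i) (fun i => by
      have h := hu i
      have : ∑ k, adjacencyMatrix E i k * (-u k - -u i) = -c := by
        rw [← h, ← Finset.sum_neg_distrib]
        exact Finset.sum_congr rfl fun k _ => by ring
      linarith) i k
    linarith

theorem eq_of_negLaplacian_const {E : Multiset (V × V)} (hE : StronglyConnected E) {v : V → ℂ}
    (hv : ∀ i k, (negLaplacian E).mulVec v i = (negLaplacian E).mulVec v k) (i k : V) :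
    v i = v k := by
  have hre : ∀ j, ∑ k, adjacencyMatrix E j k * ((v k).re - (v j).re) =
      ((negLaplacian E).mulVec v j).re := fun j => by
    rw [negLaplacian_mulVec]; simp
  have him : ∀ j, ∑ k, adjacencyMatrix E j k * ((v k).im - (v j).im) =
      ((negLaplacian E).mulVec v j).im := fun j => by
    rw [negLaplacian_mulVec]; simp
  apply Complex.ext
  · exact eq_of_laplacian_const hE (u := fun i => (v i).re) (fun j => (hre j).trans (by rw [hv j i])) i k
  · exact eq_of_laplacian_const hE (u := fun i => (v i).im) (fun j => (him j).trans (by rw [hv j i])) i k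

theorem negLaplacian_mulVec_of_const {E : Multiset (V × V)} {v : V → ℂ} (hv : ∀ i k, v i = v k) :
    (negLaplacian E).mulVec v = 0 := by
  ext i
  rw [negLaplacian_mulVec]
  exact Finset.sum_eq_zero fun k _ => by rw [hv k i]; simp

/-- Each factor is removed in turn: if `N v` is constant, so is `v`. -/
theorem eq_of_negLaplacian_pow {E : Multiset (V × V)} (hE : StronglyConnected E) (r : ℕ)
    {v : V → ℂ} (hv : ((negLaplacian E) ^ r).mulVec v = 0) (i k : V) : v i = v k := by
  induction r generalizing v i k with
  | zero => simp at hv; simp [hv]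
  | succ r ih =>
    rw [pow_succ, ← Matrix.mulVec_mulVec] at hv
    exact eq_of_negLaplacian_const hE (fun i k => ih hv i k) i k

/-- The functionals that vanish on constant vectors are killed by the product of `-L - μ` over
the nonzero eigenvalues `μ`. -/
theorem vecMul_prod_nonzero_eigenvalues {E : Multiset (V × V)} (hE : StronglyConnected E)
    {w : V → ℂ} (hw : ∑ i, w i = 0) :
    Matrix.vecMul w (aeval (negLaplacian E) ((((negLaplacian E).charpoly.roots.filter
      (· ≠ 0)).map fun μ => X - C μ).prod)) = 0 := by
  set N := negLaplacian E
  set P := ((N.charpoly.roots.filter (· ≠ 0)).map fun μ : ℂ => X - C μ).prod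
  have h0 : ((N.charpoly.roots.filter (· = 0)).map fun μ : ℂ => X - C μ).prod =
      X ^ (N.charpoly.roots.filter (· = 0)).card := by
    rw [Multiset.filter_eq' _ 0]
    simp
  have h1 := aeval_charpoly_eq_prod N
  rw [← Multiset.filter_add_not (· = 0) N.charpoly.roots, Multiset.map_add, Multiset.prod_add, h0,
    map_mul, map_pow, aeval_X] at h1
  ext j
  -- The columns of `P(N)` lie in the kernel of a power of `N`, hence are constant, and `w`
  -- annihilates constants.
  have h2 := eq_of_negLaplacian_pow hE (N.charpoly.roots.filter (· = 0)).card
    (v := (aeval N P).mulVec (Pi.single j 1)) (by rw [Matrix.mulVec_mulVec, h1, Matrix.zero_mulVec])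
  rw [← dotProduct_single_one (Matrix.vecMul w (aeval N P)) j, ← Matrix.dotProduct_mulVec]
  simp only [dotProduct, h2 _ j, ← Finset.sum_mul, hw]
  simp

/-! ### The closed-loop matrices -/

/-- The state matrix `A + l B K` of one agent with feedback gain `l`. -/
def closedLoop (a b : ℝ[X]) (l : ℂ) : Matrix (Fin a.natDegree) (Fin a.natDegree) ℂ :=
  (stateMatrix a).map (fun x : ℝ => (x : ℂ)) +
    l • Matrix.vecMulVec (fun i => (inputVector a i : ℂ)) (fun j => (gainRow a b j : ℂ))

theorem closedLoop_mulVec (a b : ℝ[X]) (l : ℂ) (x : Fin a.natDegree → ℂ) (i : Fin a.natDegree) :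
    (closedLoop a b l).mulVec x i =
      ((stateMatrix a).map (fun x : ℝ => (x : ℂ))).mulVec x i +
        l * (∑ j : Fin a.natDegree, (b.coeff j : ℂ) * x j) * (inputVector a i : ℂ) := by
  rw [closedLoop, Matrix.add_mulVec, Pi.add_apply, Matrix.smul_mulVec, Matrix.vecMulVec_mulVec]
  simp [dotProduct, gainRow]
  ring

theorem sum_coeff_mul_pow {a b : ℝ[X]} (hab : b.natDegree < a.natDegree) (s : ℂ) :
    ∑ j : Fin a.natDegree, (b.coeff j : ℂ) * s ^ (j : ℕ) = aeval s b := by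
  rw [aeval_eq_sum_range' hab, Finset.sum_range]
  simp

theorem stateMatrix_mulVec_pow {a : ℝ[X]} (ha : a.Monic) (s : ℂ) (i : Fin a.natDegree) :
    ((stateMatrix a).map (fun x : ℝ => (x : ℂ))).mulVec (fun j => s ^ (j : ℕ)) i =
      s * s ^ (i : ℕ) - aeval s a * (inputVector a i : ℂ) := by
  simp only [Matrix.mulVec, dotProduct, Matrix.map_apply, stateMatrix, Matrix.of_apply,
    inputVector]
  by_cases hi : (i : ℕ) + 1 = a.natDegree
  · have h1 : aeval s a = (∑ j : Fin a.natDegree, (a.coeff j : ℂ) * s ^ (j : ℕ)) +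
        s ^ a.natDegree := by
      rw [aeval_eq_sum_range, Finset.sum_range_succ, Finset.sum_range, ha.coeff_natDegree]
      simp
    simp only [if_pos hi, Complex.ofReal_neg, neg_mul, Finset.sum_neg_distrib]
    rw [h1, ← pow_succ', hi]
    simp
  · have hlt : (i : ℕ) + 1 < a.natDegree := by omega
    simp only [if_neg hi]
    rw [Finset.sum_eq_single ⟨i + 1, hlt⟩]
    · simp [pow_succ']
    · intro j _ hj
      rw [if_neg fun h => hj (Fin.ext h)]
      simp
    · simp

/-- Feedback enters only the last row. The other rows act as a shift, making each coordinate `μ`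
times the previous one. -/
theorem eq_smul_pow_of_eigenvector {a b : ℝ[X]} (hab : b.natDegree < a.natDegree) {l μ : ℂ}
    {x : Fin a.natDegree → ℂ} (hx : (closedLoop a b l).mulVec x = μ • x) :
    x = fun j : Fin a.natDegree => x ⟨0, by omega⟩ * μ ^ (j : ℕ) := by
  have h : ∀ (k : ℕ) (hk : k < a.natDegree), x ⟨k, hk⟩ = x ⟨0, by omega⟩ * μ ^ k := by
    intro k
    induction k with
    | zero => intro hk; simp
    | succ k ih =>
      intro hk
      have h1 := congrFun hx ⟨k, by omega⟩
      rw [closedLoop_mulVec] at h1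
      have hne : k + 1 ≠ a.natDegree := by omega
      simp only [Matrix.mulVec, dotProduct, Matrix.map_apply, stateMatrix, Matrix.of_apply,
        inputVector, if_neg hne, Pi.smul_apply, smul_eq_mul] at h1
      rw [Finset.sum_eq_single ⟨k + 1, hk⟩] at h1
      · rw [ih (by omega)] at h1
        simp only [if_true, Complex.ofReal_one, one_mul, Complex.ofReal_zero, mul_zero,
          add_zero] at h1
        rw [h1]
        ring
      · intro j _ hj
        rw [if_neg fun h => hj (Fin.ext h)]
        simp
      · simp
  ext j
  exact h j j.2

theorem root_of_mem_spectrum_closedLoop {a b : ℝ[X]} (ha : a.Monic)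
    (hab : b.natDegree < a.natDegree) {l μ : ℂ} (hμ : μ ∈ spectrum ℂ (closedLoop a b l)) :
    aeval μ a = l * aeval μ b := by
  obtain ⟨x, hx0, hx⟩ := exists_eigenvector hμ
  have hpow := eq_smul_pow_of_eigenvector hab hx
  set c := x ⟨0, by omega⟩
  have hc : c ≠ 0 := fun h => hx0 (by rw [hpow, h]; ext; simp)
  have hx' : x = c • fun j : Fin a.natDegree => μ ^ (j : ℕ) := hpow
  -- The last row is the only one that carries the characteristic equation.
  have h1 := congrFun hx ⟨a.natDegree - 1, by omega⟩
  rw [hx', Matrix.mulVec_smul, Pi.smul_apply, closedLoop_mulVec, sum_coeff_mul_pow hab,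
    stateMatrix_mulVec_pow ha] at h1
  have hB : inputVector a ⟨a.natDegree - 1, by omega⟩ = 1 := by
    simp only [inputVector]
    rw [if_pos (by omega)]
  rw [hB] at h1
  simp only [Pi.smul_apply, smul_eq_mul, Complex.ofReal_one, mul_one] at h1
  have h2 : c * (aeval μ a - l * aeval μ b) = 0 := by linear_combination -h1
  exact sub_eq_zero.1 ((mul_eq_zero.1 h2).resolve_left hc)

/-! ### The complexified network system -/

/-- The right-hand side of the network system, for complex states. -/
def complexField (a b : ℝ[X]) (E : Multiset (V × V)) (Z : V → Fin a.natDegree → ℂ) (i : V)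
    (j : Fin a.natDegree) : ℂ :=
  ((stateMatrix a).map (fun x : ℝ => (x : ℂ))).mulVec (Z i) j +
    (∑ r : Fin a.natDegree, (b.coeff r : ℂ) * (negLaplacian E).mulVec (fun k => Z k r) i) *
      (inputVector a j : ℂ)

theorem field_apply (a b : ℝ[X]) (E : Multiset (V × V)) (ξ : V → Fin a.natDegree → ℝ) (i : V)
    (j : Fin a.natDegree) :
    (Matrix.mulVec (stateMatrix a) (ξ i) + control a b E ξ i • inputVector a) j =
      ∑ r, stateMatrix a j r * ξ i r +
        (∑ r : Fin a.natDegree, b.coeff r * ∑ k, adjacencyMatrix E i k * (ξ k r - ξ i r)) *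
          inputVector a j := by
  simp [Matrix.mulVec, dotProduct, control, gainRow, Finset.sum_apply]

theorem complexField_ofReal (a b : ℝ[X]) (E : Multiset (V × V)) (ξ : V → Fin a.natDegree → ℝ)
    (i : V) (j : Fin a.natDegree) :
    complexField a b E (fun i j => (ξ i j : ℂ)) i j =
      (((Matrix.mulVec (stateMatrix a) (ξ i) + control a b E ξ i • inputVector a) j : ℝ) : ℂ) := by
  rw [field_apply]
  simp only [complexField, negLaplacian_mulVec]
  simp only [Matrix.mulVec, dotProduct, Matrix.map_apply]
  push_cast
  rfl

/-- All coefficients are real, so real parts of complex solutions are genuine trajectories. -/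
theorem re_complexField (a b : ℝ[X]) (E : Multiset (V × V)) (Z : V → Fin a.natDegree → ℂ)
    (i : V) (j : Fin a.natDegree) :
    (complexField a b E Z i j).re =
      (Matrix.mulVec (stateMatrix a) (fun j => (Z i j).re) +
        control a b E (fun i j => (Z i j).re) i • inputVector a) j := by
  rw [field_apply a b E (fun i j => (Z i j).re)]
  simp only [complexField, negLaplacian_mulVec]
  simp only [Matrix.mulVec, dotProduct, Matrix.map_apply]
  simp

/-- This is the cascade identity: replacing `w N` by `l w + w (N - l)` turns the coupling into
feedback with gain `l` plus an input from the functional `w (N - l)`. -/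
theorem sum_mul_complexField (a b : ℝ[X]) (E : Multiset (V × V)) (Z : V → Fin a.natDegree → ℂ)
    (w : V → ℂ) (l : ℂ) (j : Fin a.natDegree) :
    ∑ i, w i * complexField a b E Z i j =
      (closedLoop a b l).mulVec (fun r => ∑ i, w i * Z i r) j +
        (∑ r : Fin a.natDegree, (b.coeff r : ℂ) *
          ∑ i, Matrix.vecMul w (negLaplacian E - l • 1) i * Z i r) * (inputVector a j : ℂ) := by
  have h1 : ∀ r : Fin a.natDegree,
      ∑ i, Matrix.vecMul w (negLaplacian E - l • 1) i * Z i r =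
        ∑ i, w i * (negLaplacian E).mulVec (fun k => Z k r) i - l * ∑ i, w i * Z i r := by
    intro r
    have := Matrix.dotProduct_mulVec w (negLaplacian E - l • 1) (fun k => Z k r)
    rw [Matrix.sub_mulVec, Matrix.smul_mulVec, Matrix.one_mulVec, dotProduct_sub,
      dotProduct_smul] at this
    exact this.symm
  have h2 : ∑ i, w i * ((stateMatrix a).map (fun x : ℝ => (x : ℂ))).mulVec (Z i) j =
      ((stateMatrix a).map (fun x : ℝ => (x : ℂ))).mulVec (fun r => ∑ i, w i * Z i r) j := by
    simp only [Matrix.mulVec, dotProduct, Finset.mul_sum]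
    rw [Finset.sum_comm]
    exact Finset.sum_congr rfl fun r _ => Finset.sum_congr rfl fun i _ => by ring
  have h3 : ∑ i, w i * ((∑ r : Fin a.natDegree, (b.coeff r : ℂ) *
        (negLaplacian E).mulVec (fun k => Z k r) i) * (inputVector a j : ℂ)) =
      (∑ r : Fin a.natDegree, (b.coeff r : ℂ) *
        ∑ i, w i * (negLaplacian E).mulVec (fun k => Z k r) i) * (inputVector a j : ℂ) := by
    simp only [Finset.mul_sum, Finset.sum_mul]
    rw [Finset.sum_comm]
    exact Finset.sum_congr rfl fun r _ => Finset.sum_congr rfl fun i _ => by ring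
  rw [closedLoop_mulVec]
  simp only [h1, complexField, mul_add, Finset.sum_add_distrib, h2, h3, mul_sub,
    Finset.sum_sub_distrib, sub_mul]
  have h4 : ∑ r : Fin a.natDegree, (b.coeff r : ℂ) * (l * ∑ i, w i * Z i r) =
      l * ∑ r : Fin a.natDegree, (b.coeff r : ℂ) * ∑ i, w i * Z i r := by
    rw [Finset.mul_sum]
    exact Finset.sum_congr rfl fun r _ => by ring
  rw [h4]
  ring

/-! ### Consensus in terms of the spectrum -/

/-- `a - l b` has no zero in the closed right half-plane. -/
def Stable (a b : ℝ[X]) (l : ℂ) : Prop :=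
  ∀ s : ℂ, 0 ≤ s.re → aeval s a ≠ l * aeval s b

theorem tendsto_sum_mul_zero {a b : ℝ[X]} (ha : a.Monic) (hab : b.natDegree < a.natDegree)
    {E : Multiset (V × V)} {ξ : ℝ → V → Fin a.natDegree → ℝ} (hξ : IsTrajectory a b E ξ)
    (s : Multiset ℂ) (hs : ∀ l ∈ s, Stable a b l) :
    ∀ w : V → ℂ, Matrix.vecMul w (aeval (negLaplacian E) ((s.map fun l => X - C l).prod)) = 0 →
      Tendsto (fun t (j : Fin a.natDegree) => ∑ i, w i * (ξ t i j : ℂ)) atTop (𝓝 0) := by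
  induction s using Multiset.induction with
  | empty =>
    intro w hw
    simp at hw
    simp only [hw, Pi.zero_apply, zero_mul, Finset.sum_const_zero]
    exact tendsto_const_nhds
  | cons l s ih =>
    intro w hw
    have h1 := ih (fun ν hν => hs ν (Multiset.mem_cons_of_mem hν))
      (Matrix.vecMul w (negLaplacian E - l • 1)) (by
        simpa [Matrix.vecMul_vecMul, Algebra.algebraMap_eq_smul_one] using hw)
    have hg : Tendsto (fun t (j : Fin a.natDegree) => (∑ r : Fin a.natDegree, (b.coeff r : ℂ) *
          ∑ i, Matrix.vecMul w (negLaplacian E - l • 1) i * (ξ t i r : ℂ)) *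
            (inputVector a j : ℂ)) atTop (𝓝 0) := by
      have hc : Continuous fun (y : Fin a.natDegree → ℂ) (j : Fin a.natDegree) =>
          (∑ r : Fin a.natDegree, (b.coeff r : ℂ) * y r) * (inputVector a j : ℂ) := by fun_prop
      have h := (hc.tendsto 0).comp h1
      have h0 : (fun j : Fin a.natDegree => (∑ r : Fin a.natDegree, (b.coeff r : ℂ) *
          (0 : Fin a.natDegree → ℂ) r) * (inputVector a j : ℂ)) = 0 := by
        ext j; simp
      rw [h0] at h
      exact h
    refine tendsto_zero_of_stable (M := closedLoop a b l) ?_ ?_ hg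
    · intro μ hμ
      by_contra hre
      exact hs l (Multiset.mem_cons_self _ _) μ (not_lt.1 hre)
        (root_of_mem_spectrum_closedLoop ha hab hμ)
    · intro t ht
      rw [hasDerivWithinAt_pi]
      intro j
      have h2 : HasDerivWithinAt (fun t => ∑ i, w i * (ξ t i j : ℂ))
          (∑ i, w i * complexField a b E (fun i j => (ξ t i j : ℂ)) i j) (Set.Ici 0) t := by
        refine HasDerivWithinAt.fun_sum fun i _ => HasDerivWithinAt.const_mul (w i) ?_
        rw [complexField_ofReal]
        exact ((hasDerivWithinAt_pi.1 (hξ t ht i)) j).ofReal_comp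
      rw [sum_mul_complexField a b E _ w l j] at h2
      exact h2

theorem reachesConsensus_of_stable {a b : ℝ[X]} (ha : a.Monic) (hab : b.natDegree < a.natDegree)
    {E : Multiset (V × V)} (hE : StronglyConnected E)
    (h : ∀ l ∈ spectrum ℂ (negLaplacian E), l ≠ 0 → Stable a b l) : ReachesConsensus a b E := by
  intro ξ hξ i k
  have h1 := tendsto_sum_mul_zero ha hab hξ ((negLaplacian E).charpoly.roots.filter (· ≠ 0))
    (fun l hl => h l (Matrix.mem_spectrum_of_isRoot_charpoly
      (isRoot_of_mem_roots (Multiset.mem_of_mem_filter hl))) (Multiset.mem_filter.1 hl).2)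
    -- This functional reads off the disagreement of agents `i` and `k`; its entries sum to zero.
    (Pi.single i 1 - Pi.single k 1)
    (vecMul_prod_nonzero_eigenvalues hE (by simp))
  rw [← tendsto_zero_iff_norm_tendsto_zero, tendsto_pi_nhds]
  intro j
  have h2 := (Complex.continuous_re.tendsto _).comp ((tendsto_pi_nhds.1 h1) j)
  simpa [Function.comp_def, sub_mul, Finset.sum_sub_distrib, Pi.single_apply] using h2

theorem isTrajectory_re_exp {a b : ℝ[X]} (ha : a.Monic) (hab : b.natDegree < a.natDegree)
    {E : Multiset (V × V)} {l s : ℂ} {v : V → ℂ} (hv : (negLaplacian E).mulVec v = l • v)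
    (hs : aeval s a = l * aeval s b) :
    IsTrajectory a b E fun t i j => (Complex.exp (s * t) * v i * s ^ (j : ℕ)).re := by
  intro t _ i
  rw [hasDerivWithinAt_pi]
  intro j
  rw [← re_complexField a b E (fun i j => Complex.exp (s * t) * v i * s ^ (j : ℕ))]
  have h1 : complexField a b E (fun i j => Complex.exp (s * t) * v i * s ^ (j : ℕ)) i j =
      s * (Complex.exp (s * t) * v i * s ^ (j : ℕ)) := by
    have h2 : ((stateMatrix a).map (fun x : ℝ => (x : ℂ))).mulVec
        (fun j => Complex.exp (s * t) * v i * s ^ (j : ℕ)) j =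
        Complex.exp (s * t) * v i * (s * s ^ (j : ℕ) - aeval s a * (inputVector a j : ℂ)) := by
      rw [← stateMatrix_mulVec_pow ha]
      exact congrFun (Matrix.mulVec_smul _ (Complex.exp (s * t) * v i)
        (fun j : Fin a.natDegree => s ^ (j : ℕ))) j
    have h3 : ∀ r : ℕ, (negLaplacian E).mulVec (fun k => Complex.exp (s * t) * v k * s ^ r) i =
        Complex.exp (s * t) * l * v i * s ^ r := by
      intro r
      have : (fun k => Complex.exp (s * t) * v k * s ^ r) = (Complex.exp (s * t) * s ^ r) • v := by
        ext k; simp; ring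
      rw [this, Matrix.mulVec_smul, hv]
      simp
      ring
    have h4 : ∑ r : Fin a.natDegree, (b.coeff r : ℂ) * (Complex.exp (s * t) * l * v i * s ^ (r : ℕ))
        = Complex.exp (s * t) * l * v i * aeval s b := by
      rw [← sum_coeff_mul_pow hab, Finset.mul_sum]
      exact Finset.sum_congr rfl fun r _ => by ring
    simp only [complexField, h2, h3, h4, hs]
    ring
  rw [h1]
  have h5 : HasDerivAt (fun t : ℝ => Complex.exp (s * t)) (Complex.exp (s * t) * (s * 1)) t :=
    ((Complex.ofRealCLM.hasDerivAt (x := t)).const_mul s).cexp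
  have h6 := (h5.mul_const (v i)).mul_const (s ^ (j : ℕ))
  have h7 := (Complex.reCLM.hasFDerivAt.comp_hasDerivAt t h6).hasDerivWithinAt (s := Set.Ici 0)
  refine h7.congr_deriv ?_
  rw [Complex.reCLM_apply]
  congr 1
  ring

theorem stable_of_reachesConsensus {a b : ℝ[X]} (ha : a.Monic) (hab : b.natDegree < a.natDegree)
    {E : Multiset (V × V)} (h : ReachesConsensus a b E) {l : ℂ}
    (hl : l ∈ spectrum ℂ (negLaplacian E)) (hl0 : l ≠ 0) : Stable a b l := by
  intro s hs hroot
  obtain ⟨v, hv0, hv⟩ := exists_eigenvector hl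
  have hre : ∀ u : V → ℂ, (negLaplacian E).mulVec u = l • u → ∀ i k,
      Tendsto (fun t : ℝ => (Complex.exp (s * t) * (u i - u k)).re) atTop (𝓝 0) := by
    intro u hu i k
    have h1 := h _ (isTrajectory_re_exp ha hab hu hroot) i k
    rw [← tendsto_zero_iff_norm_tendsto_zero, tendsto_pi_nhds] at h1
    have h2 := h1 ⟨0, by omega⟩
    simp only [pow_zero, mul_one, Pi.sub_apply, Pi.zero_apply, ← Complex.sub_re, ← mul_sub] at h2
    exact h2
  have hconst : ∀ i k, v i = v k := by
    intro i k
    have h1 := hre v hv i k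
    -- Consensus speaks only of real trajectories; rotating the eigenvector by `-i` recovers the
    -- imaginary part.
    have h2 := hre (-Complex.I • v) (by rw [Matrix.mulVec_smul, hv, smul_comm]) i k
    have h3 := h1.norm.add h2.norm
    simp only [norm_zero, add_zero] at h3
    have h4 : ‖v i - v k‖ ≤ 0 := by
      refine ge_of_tendsto h3 ((eventually_ge_atTop 0).mono fun t ht => ?_)
      have h5 : Complex.exp (s * t) * ((-Complex.I • v) i - (-Complex.I • v) k) =
          -Complex.I * (Complex.exp (s * t) * (v i - v k)) := by
        simp; ring
      rw [h5]
      set q := Complex.exp (s * t) * (v i - v k) with hq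
      -- The exponential has modulus at least one, since `Re s ≥ 0` and `t ≥ 0`.
      have h6 : ‖v i - v k‖ ≤ ‖q‖ := by
        rw [hq, norm_mul, Complex.norm_exp]
        refine le_mul_of_one_le_left (norm_nonneg _) (Real.one_le_exp ?_)
        simpa using mul_nonneg hs ht
      refine h6.trans ((Complex.norm_le_abs_re_add_abs_im q).trans ?_)
      simp
    exact sub_eq_zero.1 (norm_le_zero_iff.1 h4)
  rw [negLaplacian_mulVec_of_const hconst] at hv
  exact (smul_ne_zero hl0 hv0) hv.symm

/-! ### The consensus region is open -/

theorem mem_consensusRegion_iff {a b : ℝ[X]}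
    (hcommon : ∀ s : ℂ, 0 ≤ s.re → aeval s a = 0 → aeval s b ≠ 0) {l : ℂ} :
    l ∈ consensusRegion a b ↔ Stable a b l := by
  constructor
  · intro h s hs hroot
    have hb : aeval s b ≠ 0 := fun hb => hcommon s hs (by rw [hroot, hb, mul_zero]) hb
    exact h s hs hb (by rw [phi, hroot, mul_div_cancel_right₀ _ hb, sub_self])
  · intro h s hs hb h0
    exact h s hs ((div_eq_iff hb).1 (sub_eq_zero.1 h0))

/-- The zeros of `a - l b` are bounded, locally uniformly in `l`. -/
theorem exists_root_bound {a b : ℝ[X]} (ha : a.Monic) (hab : b.natDegree < a.natDegree) (r : ℝ) :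
    ∃ C : ℝ, ∀ l s : ℂ, ‖l‖ ≤ r → aeval s a = l * aeval s b → ‖s‖ ≤ C := by
  refine ⟨(∑ j ∈ Finset.range a.natDegree, (‖a.coeff j‖ + r * ‖b.coeff j‖)) + 1,
    fun l s hl hs => ?_⟩
  -- As `deg b < deg a`, the polynomial stays monic of degree `deg a` for every `l`, so Cauchy's
  -- root bound is uniform on `‖l‖ ≤ r`.
  set p : ℂ[X] := a.map (algebraMap ℝ ℂ) - C l * b.map (algebraMap ℝ ℂ) with hp
  have hdeg : (C l * b.map (algebraMap ℝ ℂ)).degree < (a.map (algebraMap ℝ ℂ)).degree := by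
    refine (degree_mul_le _ _).trans_lt ((add_le_add_left degree_C_le _).trans_lt ?_)
    rw [zero_add, degree_map, degree_map]
    exact degree_lt_degree hab
  have hmonic : p.Monic := (ha.map _).sub_of_left hdeg
  have hnat : p.natDegree = a.natDegree := by
    rw [hp, natDegree_eq_of_degree_eq (degree_sub_eq_left_of_degree_lt hdeg), natDegree_map]
  have hroot : p.IsRoot s := by
    simp only [hp, IsRoot, eval_sub, eval_mul, eval_C, eval_map_algebraMap, hs, sub_self]
  have h1 := hroot.norm_lt_cauchyBound hmonic.ne_zero
  have h2 : ((p.cauchyBound : NNReal) : ℝ) ≤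
      (∑ j ∈ Finset.range a.natDegree, (‖a.coeff j‖ + r * ‖b.coeff j‖)) + 1 := by
    rw [cauchyBound, hmonic.leadingCoeff, hnat]
    simp only [nnnorm_one, div_one, NNReal.coe_add, NNReal.coe_one, add_le_add_iff_right]
    have h3 : (Finset.range a.natDegree).sup (fun x => ‖p.coeff x‖₊) ≤
        ∑ j ∈ Finset.range a.natDegree, ‖p.coeff j‖₊ :=
      Finset.sup_le fun j hj => Finset.single_le_sum (f := fun j => ‖p.coeff j‖₊)
        (fun _ _ => zero_le) hj
    refine (NNReal.coe_le_coe.2 h3).trans ?_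
    push_cast
    refine Finset.sum_le_sum fun j _ => ?_
    rw [hp, coeff_sub, coeff_C_mul, coeff_map, coeff_map]
    refine (norm_sub_le _ _).trans ?_
    rw [norm_mul, norm_algebraMap', norm_algebraMap']
    gcongr
  exact (show ‖s‖ < p.cauchyBound from h1).le.trans h2

/-- Near `l₀` the pairs of a gain and an unstable zero form a compact set, because the zeros stay
bounded. Its projection to the gains is closed and misses `l₀`. -/
theorem isOpen_setOf_stable {a b : ℝ[X]} (ha : a.Monic) (hab : b.natDegree < a.natDegree) :
    IsOpen {l | Stable a b l} := by
  rw [isOpen_iff_mem_nhds]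
  intro l₀ hl₀
  obtain ⟨C, hC⟩ := exists_root_bound ha hab (‖l₀‖ + 1)
  have hclosed : IsClosed {q : ℂ × ℂ | 0 ≤ q.2.re ∧ aeval q.2 a = q.1 * aeval q.2 b} := by
    refine (isClosed_le continuous_const (Complex.continuous_re.comp continuous_snd)).inter (isClosed_eq ?_ ?_)
    · exact (Polynomial.continuous_aeval a).comp continuous_snd
    · exact continuous_fst.mul ((Polynomial.continuous_aeval b).comp continuous_snd)
  have hK : IsCompact ((Metric.closedBall l₀ 1 ×ˢ Metric.closedBall (0 : ℂ) C) ∩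
      {q : ℂ × ℂ | 0 ≤ q.2.re ∧ aeval q.2 a = q.1 * aeval q.2 b}) :=
    ((isCompact_closedBall l₀ 1).prod (isCompact_closedBall 0 C)).inter_right hclosed
  have himage := (hK.image continuous_fst).isClosed
  have hmem : l₀ ∉ Prod.fst '' ((Metric.closedBall l₀ 1 ×ˢ Metric.closedBall (0 : ℂ) C) ∩
      {q : ℂ × ℂ | 0 ≤ q.2.re ∧ aeval q.2 a = q.1 * aeval q.2 b}) := by
    rintro ⟨⟨l, s⟩, ⟨-, hs, hroot⟩, rfl⟩
    exact hl₀ s hs hroot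
  filter_upwards [himage.isOpen_compl.mem_nhds hmem, Metric.closedBall_mem_nhds l₀ one_pos]
    with l hl hball s hs hroot
  have hnorm : ‖l‖ ≤ ‖l₀‖ + 1 := by
    have := norm_sub_norm_le l l₀
    have := mem_closedBall_iff_norm.1 hball
    linarith
  exact hl ⟨(l, s), ⟨⟨hball, by simpa using hC l s hnorm hroot⟩, hs, hroot⟩, rfl⟩

/-! ### Ring digraphs -/

theorem mem_ringArcs_of_succ {m n : ℕ} (R : Finset (Fin n)) (i : Fin m) {p : ℕ}
    (hp : p + 1 < n) : ((i, ⟨p + 1, hp⟩), (i, ⟨p, by omega⟩)) ∈ ringArcs m n R := by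
  rw [ringArcs, Multiset.mem_add]
  left
  simp [macroVertexArcs]

theorem mem_ringArcs_of_link {m n : ℕ} (R : Finset (Fin n)) (i : Fin m) (hn : 1 ≤ n) :
    ((finRotate m i, ⟨0, by omega⟩), (i, ⟨n - 1, by omega⟩)) ∈ ringArcs m n R := by
  rw [ringArcs, Multiset.mem_add]
  right
  simp only [linkArcs, Finset.mem_val, Finset.mem_filter, Finset.mem_univ, true_and]
  omega

-- The main paths and the links already form a Hamiltonian cycle: descend to the first node of a
-- copy, then pass to the last node of the preceding copy. Reverse arcs play no role.
open Fin.CommRing in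
theorem stronglyConnected_ringArcs {m n : ℕ} (hn : 1 ≤ n) (R : Finset (Fin n)) :
    StronglyConnected (ringArcs m n R) := by
  intro S ⟨⟨i₀, p₀⟩, h₀⟩ hS
  have hdown : ∀ (i : Fin m) (p q : ℕ) (hp : p < n) (hq : q ≤ p), (i, (⟨p, hp⟩ : Fin n)) ∈ S →
      (i, (⟨q, by omega⟩ : Fin n)) ∈ S := by
    intro i p
    induction p with
    | zero => intro q hp hq h; obtain rfl : q = 0 := by omega
              exact h
    | succ p ih =>
      intro q hp hq h
      rcases Nat.lt_or_ge p q with hlt | hge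
      · obtain rfl : q = p + 1 := by omega
        exact h
      · exact ih q (by omega) hge (hS _ h _ (mem_ringArcs_of_succ R i hp))
  have hall : ∀ (i : Fin m) (p : Fin n), (finRotate m i, p) ∈ S → ∀ q : Fin n, (i, q) ∈ S := by
    intro i p h q
    have h1 := hdown _ p 0 p.2 (Nat.zero_le _) h
    exact hdown i (n - 1) q _ (by omega) (hS _ h1 _ (mem_ringArcs_of_link R i hn))
  -- Zero steps are excluded, since initially only the one node `p₀` of copy `i₀` is known to be in
  -- `S`.
  have hback : ∀ (j : ℕ) (i : Fin m), ((finRotate m) ^ j) i = i₀ → ∀ q : Fin n,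
      j ≠ 0 → (i, q) ∈ S := by
    intro j
    induction j with
    | zero => intro i _ q h; exact absurd rfl h
    | succ j ih =>
      intro i hi q _
      rw [pow_succ, Equiv.Perm.mul_apply] at hi
      rcases Nat.eq_zero_or_pos j with rfl | hj
      · rw [pow_zero, Equiv.Perm.one_apply] at hi
        exact hall i p₀ (by rw [hi]; exact h₀) q
      · exact hall i q (ih _ hi q hj.ne') q
  have hm : 0 < m := i₀.pos
  obtain ⟨m, rfl⟩ : ∃ k, m = k + 1 := ⟨m - 1, by omega⟩
  have hrot : ∀ (j : ℕ) (i : Fin (m + 1)), ((finRotate (m + 1)) ^ j) i = i + (j : Fin (m + 1)) := by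
    intro j
    induction j with
    | zero => intro i; simp
    | succ j ih =>
      intro i
      rw [pow_succ, Equiv.Perm.mul_apply, ih, finRotate_apply]
      push_cast
      abel
  ext ⟨i, q⟩
  refine ⟨fun _ => Set.mem_univ _, fun _ => ?_⟩
  -- An extra full turn keeps the number of steps nonzero even when `i = i₀`.
  refine hback ((i₀ - i : Fin (m + 1)).val + (m + 1)) i ?_ q (by omega)
  rw [hrot]
  simp

/-- The action of `-L` on vectors `(i, p) ↦ ω ^ i * w p` with `ω ^ m = 1`. -/
def blockSymbol (n : ℕ) (R : Finset (Fin n)) (ω : ℂ) : Matrix (Fin n) (Fin n) ℂ :=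
  Matrix.of fun p q =>
    ((if (p : ℕ) = (q : ℕ) + 1 ∨ ((q : ℕ) = (p : ℕ) + 1 ∧ p ∈ R) then 1 else 0) +
      if (p : ℕ) = 0 ∧ (q : ℕ) + 1 = n then ω⁻¹ else 0) -
    if p = q then ∑ r : Fin n,
      ((if (p : ℕ) = (r : ℕ) + 1 ∨ ((r : ℕ) = (p : ℕ) + 1 ∧ p ∈ R) then 1 else 0) +
        if (p : ℕ) = 0 ∧ (r : ℕ) + 1 = n then 1 else 0)
    else 0

theorem adjacencyMatrix_ringArcs (m n : ℕ) (R : Finset (Fin n)) (i k : Fin m) (p q : Fin n) :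
    adjacencyMatrix (ringArcs m n R) (i, p) (k, q) =
      (if i = k ∧ ((p : ℕ) = (q : ℕ) + 1 ∨ ((q : ℕ) = (p : ℕ) + 1 ∧ p ∈ R)) then 1 else 0) +
        if i = finRotate m k ∧ (p : ℕ) = 0 ∧ (q : ℕ) + 1 = n then 1 else 0 := by
  simp only [adjacencyMatrix, ringArcs, Matrix.of_apply, Multiset.count_add, Nat.cast_add,
    Multiset.count_eq_of_nodup (Finset.nodup _), Finset.mem_val, macroVertexArcs, linkArcs,
    Finset.mem_filter, Finset.mem_univ, true_and, Nat.cast_ite, Nat.cast_one, Nat.cast_zero]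

theorem pow_finRotate {m : ℕ} {ω : ℂ} (hω : ω ^ m = 1) (k : Fin m) :
    ω ^ (finRotate m k : ℕ) = ω * ω ^ (k : ℕ) := by
  obtain ⟨m, rfl⟩ : ∃ k, m = k + 1 := ⟨m - 1, by have := k.pos; omega⟩
  rw [coe_finRotate]
  split_ifs with h
  · rw [h, Fin.val_last, ← pow_succ', hω, pow_zero]
  · rw [pow_succ']

theorem negLaplacian_mulVec_blockVector {m n : ℕ} (R : Finset (Fin n)) {ω : ℂ} (hm : m ≠ 0)
    (hω : ω ^ m = 1) (w : Fin n → ℂ) (i : Fin m) (p : Fin n) :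
    (negLaplacian (ringArcs m n R)).mulVec (fun x => ω ^ (x.1 : ℕ) * w x.2) (i, p) =
      ω ^ (i : ℕ) * (blockSymbol n R ω).mulVec w p := by
  have hω0 : ω ≠ 0 := fun h => by rw [h, zero_pow hm] at hω; exact zero_ne_one hω
  set j := (finRotate m).symm i with hj
  have hij : i = finRotate m j := (Equiv.apply_symm_apply _ _).symm
  have hpow : ω ^ (j : ℕ) = ω ^ (i : ℕ) * ω⁻¹ := by
    rw [hij, pow_finRotate hω]
    field_simp
  rw [negLaplacian_mulVec, Fintype.sum_prod_type, Finset.sum_comm]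
  have h1 : ∀ q : Fin n, ∑ k : Fin m, (adjacencyMatrix (ringArcs m n R) (i, p) (k, q) : ℂ) *
        (ω ^ (k : ℕ) * w q - ω ^ (i : ℕ) * w p) =
      ω ^ (i : ℕ) * (((if (p : ℕ) = (q : ℕ) + 1 ∨ ((q : ℕ) = (p : ℕ) + 1 ∧ p ∈ R) then 1 else 0) +
        if (p : ℕ) = 0 ∧ (q : ℕ) + 1 = n then ω⁻¹ else 0) * w q -
      ((if (p : ℕ) = (q : ℕ) + 1 ∨ ((q : ℕ) = (p : ℕ) + 1 ∧ p ∈ R) then 1 else 0) +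
        if (p : ℕ) = 0 ∧ (q : ℕ) + 1 = n then 1 else 0) * w p) := by
    intro q
    simp only [adjacencyMatrix_ringArcs, Complex.ofReal_add, add_mul, Finset.sum_add_distrib]
    -- Internal arcs stay in copy `i`; link arcs reach only its predecessor `j`, which accounts for
    -- the factor `ω⁻¹`.
    rw [Finset.sum_eq_single i (fun k _ hk => by simp [Ne.symm hk]) (by simp),
      Finset.sum_eq_single j (fun k _ hk => by
        rw [if_neg fun h => hk (by rw [hj, h.1, Equiv.symm_apply_apply])]; simp) (by simp),
      ← hij, hpow]
    simp only [true_and]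
    split_ifs <;> simp <;> ring
  rw [Finset.sum_congr rfl fun q _ => h1 q, ← Finset.mul_sum, Finset.sum_sub_distrib]
  congr 1
  simp only [Matrix.mulVec, dotProduct, blockSymbol, Matrix.of_apply, sub_mul,
    Finset.sum_sub_distrib, ite_mul, zero_mul, Finset.sum_ite_eq, Finset.mem_univ, if_true,
    Finset.sum_mul]

theorem det_blockSymbol_one {n : ℕ} (hn : 1 ≤ n) (R : Finset (Fin n)) :
    (blockSymbol n R 1).det = 0 := by
  rw [← Matrix.exists_mulVec_eq_zero_iff]
  refine ⟨fun _ => 1, fun h => one_ne_zero (congrFun h ⟨0, by omega⟩), ?_⟩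
  ext p
  simp [blockSymbol, Matrix.mulVec, dotProduct, Finset.sum_sub_distrib]

/-- The determinant is the product of the `n` eigenvalues, so they cannot all have modulus at least
`δ`. -/
theorem exists_eigenvalue_of_norm_det_lt {n : ℕ} {M : Matrix (Fin n) (Fin n) ℂ} {δ : ℝ}
    (hδ : 0 < δ) (h : ‖M.det‖ < δ ^ n) : ∃ μ ∈ spectrum ℂ M, ‖μ‖ < δ := by
  by_contra! hlarge
  have hcard : M.charpoly.roots.card = n := by
    rw [← (IsAlgClosed.splits M.charpoly).natDegree_eq_card_roots, Matrix.charpoly_natDegree_eq_dim,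
      Fintype.card_fin]
  have hprod : ∀ s : Multiset ℂ, (∀ μ ∈ s, δ ≤ ‖μ‖) → δ ^ s.card ≤ ‖s.prod‖ := by
    intro s
    induction s using Multiset.induction with
    | empty => simp
    | cons μ s ih =>
      intro hs
      rw [Multiset.card_cons, Multiset.prod_cons, norm_mul, pow_succ']
      exact mul_le_mul (hs μ (Multiset.mem_cons_self _ _))
        (ih fun ν hν => hs ν (Multiset.mem_cons_of_mem hν)) (by positivity) (norm_nonneg _)
  have := hprod M.charpoly.roots fun μ hμ =>
    hlarge μ (Matrix.mem_spectrum_of_isRoot_charpoly (isRoot_of_mem_roots hμ))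
  rw [hcard, ← Matrix.det_eq_prod_roots_charpoly] at this
  exact this.not_gt h

theorem mem_spectrumLocus {n : ℕ} {R : Finset (Fin n)} {l : ℂ} :
    l ∈ spectrumLocus n R ↔ ∃ m, 1 ≤ m ∧ l ∈ spectrum ℂ (negLaplacian (ringArcs m n R)) := by
  simp [spectrumLocus, negLaplacian]

theorem zero_mem_spectrumLocus {n : ℕ} (hn : 1 ≤ n) (R : Finset (Fin n)) :
    (0 : ℂ) ∈ spectrumLocus n R := by
  refine mem_spectrumLocus.2 ⟨1, le_rfl, mem_spectrum_of_mulVec (v := fun _ => 1)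
    (fun h => one_ne_zero (congrFun h (0, ⟨0, by omega⟩))) ?_⟩
  rw [zero_smul]
  exact negLaplacian_mulVec_of_const fun _ _ => rfl

/-- The origin is an accumulation point of the spectrum locus. -/
theorem exists_mem_spectrumLocus_norm_lt {n : ℕ} (hn : 1 ≤ n) (R : Finset (Fin n)) {δ : ℝ}
    (hδ : 0 < δ) : ∃ l ∈ spectrumLocus n R, l ≠ 0 ∧ ‖l‖ < δ := by
  have hcont : ContinuousAt (fun ω => (blockSymbol n R ω).det) 1 := by
    have : ContinuousAt (blockSymbol n R) 1 := by
      refine continuousAt_pi.2 fun p => continuousAt_pi.2 fun q => ?_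
      simp only [blockSymbol, Matrix.of_apply]
      refine (continuousAt_const.add ?_).sub continuousAt_const
      split_ifs
      · exact continuousAt_inv₀ one_ne_zero
      · exact continuousAt_const
    exact (continuous_id.matrix_det.continuousAt).comp this
  have hω : Tendsto (fun m : ℕ => Complex.exp (2 * Real.pi * Complex.I / m)) atTop (𝓝 1) := by
    have h := (Complex.continuous_exp.tendsto 0).comp
      (tendsto_const_div_atTop_nhds_zero_nat (2 * Real.pi * Complex.I))
    rwa [Complex.exp_zero] at h
  have hdet := (hcont.tendsto.comp hω).norm
  simp only [det_blockSymbol_one hn, norm_zero] at hdet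
  -- The determinant vanishes at `ω = 1` and is continuous there; `m ≥ 2` ensures that the primitive
  -- root is not `1`.
  obtain ⟨m, hm, hm2⟩ := ((hdet.eventually_lt_const (pow_pos hδ n)).and
    (eventually_ge_atTop 2)).exists
  have hprim := Complex.isPrimitiveRoot_exp m (by omega)
  set ω := Complex.exp (2 * Real.pi * Complex.I / m)
  obtain ⟨l, hl, hlδ⟩ := exists_eigenvalue_of_norm_det_lt hδ hm
  obtain ⟨w, hw0, hw⟩ := exists_eigenvector hl
  have hv : (negLaplacian (ringArcs m n R)).mulVec (fun x => ω ^ (x.1 : ℕ) * w x.2) =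
      l • fun x => ω ^ (x.1 : ℕ) * w x.2 := by
    ext ⟨i, p⟩
    rw [negLaplacian_mulVec_blockVector R (by omega) hprim.pow_eq_one, hw]
    simp
    ring
  obtain ⟨p, hp⟩ : ∃ p, w p ≠ 0 := by
    by_contra! h
    exact hw0 (funext h)
  refine ⟨l, mem_spectrumLocus.2 ⟨m, by omega, mem_spectrum_of_mulVec (fun h => hp ?_) hv⟩, ?_, hlδ⟩
  · simpa using congrFun h (⟨0, by omega⟩, p)
  · rintro rfl
    rw [zero_smul] at hv
    -- A kernel vector would be constant, but copies `0` and `1` differ by the factor `ω ≠ 1`.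
    have h := eq_of_negLaplacian_const (stronglyConnected_ringArcs hn R)
      (fun i k => by rw [hv]; rfl) ((⟨1, by omega⟩ : Fin m), p) (⟨0, by omega⟩, p)
    simp only [pow_one, pow_zero] at h
    exact hprim.ne_one (by omega) (mul_right_cancel₀ hp h)

theorem forall_reachesConsensus_iff {n : ℕ} (hn : 1 ≤ n) (R : Finset (Fin n)) {a b : ℝ[X]}
    (ha : a.Monic) (hab : b.natDegree < a.natDegree)
    (hcommon : ∀ s : ℂ, 0 ≤ s.re → aeval s a = 0 → aeval s b ≠ 0) :
    (∀ m : ℕ, 1 ≤ m → ReachesConsensus a b (ringArcs m n R)) ↔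
      spectrumLocus n R \ {0} ⊆ consensusRegion a b := by
  constructor
  · rintro h l ⟨hl, hl0⟩
    obtain ⟨m, hm, hlm⟩ := mem_spectrumLocus.1 hl
    exact (mem_consensusRegion_iff hcommon).2 (stable_of_reachesConsensus ha hab (h m hm) hlm hl0)
  · intro h m hm
    exact reachesConsensus_of_stable ha hab (stronglyConnected_ringArcs hn R) fun l hl hl0 =>
      (mem_consensusRegion_iff hcommon).1 (h ⟨mem_spectrumLocus.2 ⟨m, hm, hl⟩, hl0⟩)

theorem isOpen_consensusRegion {a b : ℝ[X]} (ha : a.Monic) (hab : b.natDegree < a.natDegree)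
    (hcommon : ∀ s : ℂ, 0 ≤ s.re → aeval s a = 0 → aeval s b ≠ 0) :
    IsOpen (consensusRegion a b) := by
  have : consensusRegion a b = {l | Stable a b l} :=
    Set.ext fun _ => mem_consensusRegion_iff hcommon
  rw [this]
  exact isOpen_setOf_stable ha hab

end RingConsensus

end

theorem theorem4 (n : ℕ) (hn : 1 ≤ n) (R : Finset (Fin n)) (a b : ℝ[X]) (ha : a.Monic)
    (hb : b ≠ 0) (hab : b.natDegree < a.natDegree)
    (hcommon : ∀ s : ℂ, 0 ≤ s.re → aeval s a = 0 → aeval s b ≠ 0) :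
    ((∀ m : ℕ, 1 ≤ m → RingConsensus.ReachesConsensus a b (RingConsensus.ringArcs m n R)) ↔
      (RingConsensus.spectrumLocus n R \ {0} ⊆ RingConsensus.consensusRegion a b ∧
        RingConsensus.spectrumLocus n R ∩ frontier (RingConsensus.consensusRegion a b) ⊆ {0})) ∧
    ((∃ s : ℂ, 0 ≤ s.re ∧ aeval s a = 0) →
      ((∀ m : ℕ, 1 ≤ m → RingConsensus.ReachesConsensus a b (RingConsensus.ringArcs m n R)) ↔
        (RingConsensus.spectrumLocus n R \ {0} ⊆ RingConsensus.consensusRegion a b ∧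
          RingConsensus.spectrumLocus n R ∩ frontier (RingConsensus.consensusRegion a b) =
            {0}))) := by
  rw [RingConsensus.forall_reachesConsensus_iff hn R ha hab hcommon]
  have hfrontier := (RingConsensus.isOpen_consensusRegion ha hab hcommon).frontier_eq
  have hsub : RingConsensus.spectrumLocus n R \ {0} ⊆ RingConsensus.consensusRegion a b →
      RingConsensus.spectrumLocus n R ∩ frontier (RingConsensus.consensusRegion a b) ⊆ {0} := by
    rintro h l ⟨hl, hlf⟩
    by_contra hl0
    rw [hfrontier] at hlf
    exact hlf.2 (h ⟨hl, hl0⟩)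
  refine ⟨⟨fun h => ⟨h, hsub h⟩, fun h => h.1⟩, fun ⟨s, hs, hroot⟩ =>
    ⟨fun h => ⟨h, (hsub h).antisymm ?_⟩, fun h => h.1⟩⟩
  rw [Set.singleton_subset_iff]
  refine ⟨RingConsensus.zero_mem_spectrumLocus hn R, ?_⟩
  rw [hfrontier]
  -- Nonzero points of `Λ` near `0` lie in `Ω`, so `0` is in its closure; the unstable zero of `a`
  -- keeps `0` itself out.
  refine ⟨Metric.mem_closure_iff.2 fun δ hδ => ?_, fun h0 => ?_⟩
  · obtain ⟨l, hl, hl0, hlδ⟩ := RingConsensus.exists_mem_spectrumLocus_norm_lt hn R hδ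
    exact ⟨l, h ⟨hl, hl0⟩, by rwa [dist_zero_left]⟩
  · exact (RingConsensus.mem_consensusRegion_iff hcommon).1 h0 s hs (by rw [hroot, zero_mul])
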